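/- Let $M\ge 1$ programs be given, with correctness indicators $S_i\in\{0,1\}$ ($1$ for correct), real uncertainty scores $U_i$ and sampling weights $\omega_i\in(0,1]$, $i\in[M]$; all of these are fixed, and so are a threshold $u\in\mathbb{R}$ and a level $\gamma\in(0,1)$. Put $\ell(s)=1-s$ and $$L(u)=\frac1M\sum_{i=1}^M \ell(S_i)\,\mathbf 1\{U_i<u\},\qquad L_{\le}(u)=\frac1M\sum_{i=1}^M \ell(S_i)\,\mathbf 1\{U_i\le u\}.$$ Let $(i_j,\xi_j)_{j\ge 1}$ be i.i.d. pairs, where $i_j$ is uniform on $[M]$ and, conditionally on $i_j$, $\xi_j\sim\mathrm{Bern}(\omega_{i_j})$. Let $$Z_j(u)=\ell(S_{i_j})\,\frac{\xi_j}{\omega_{i_j}}\,\mathbf 1\{U_{i_j}\le u\},\quad \hat\mu_Z(u)=\frac1h\sum_{j=1}^h Z_j(u),\quad \hat\sigma_Z(u)=\sqrt{\frac1h\sum_{j=1}^h\bigl(Z_j(u)-\hat\mu_Z(u)\bigr)^2},$$ and, for sample size $h$, $$\hat L^u(\gamma)=\hat\mu_Z(u)+z_{1-\gamma}\,\frac{\hat\sigma_Z(u)}{\sqrt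 h},$$ where $z_{1-\gamma}$ is the $(1-\gamma)$-quantile of the standard normal distribution. Then $$\liminf_{h\to\infty}\mathbb P\bigl(L(u)\le\hat L^u(\gamma)\bigr)\ge 1-\gamma,$$ and likewise $$\liminf_{h\to\infty}\mathbb P\bigl(L_{\le}(u)\le\hat L^u(\gamma)\bigr)\ge 1-\gamma.$$ -/

import Mathlib

open MeasureTheory ProbabilityTheory Filter

namespace SelectiveExecution

noncomputable section

/-- The error `ℓ(s) = 1 - s` of a correctness indicator `s ∈ {0, 1}`
(`true` is `1`, a correct program; `false` is `0`, an incorrect one). -/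
def loss (s : Bool) : ℝ := 1 - (if s then 1 else 0)

/-- The cumulative error `L(u) = (1/M) ∑ i, ℓ(S i) 1{U i < u}`. -/
def cumError {M : ℕ} (S : Fin M → Bool) (U : Fin M → ℝ) (u : ℝ) : ℝ :=
  (1 / (M : ℝ)) * ∑ i, loss (S i) * (if U i < u then 1 else 0)

/-- The same cumulative error with the closed threshold,
`(1/M) ∑ i, ℓ(S i) 1{U i ≤ u}`. -/
def cumErrorLE {M : ℕ} (S : Fin M → Bool) (U : Fin M → ℝ) (u : ℝ) : ℝ :=
  (1 / (M : ℝ)) * ∑ i, loss (S i) * (if U i ≤ u then 1 else 0)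

/-- The law of one draw `(i, ξ)`: the index `i` is uniform on the `M` programs and, given `i`,
the execution decision `ξ` is Bernoulli with success probability `w i`. -/
def drawLaw {M : ℕ} [NeZero M] (w : Fin M → unitInterval) : Measure (Fin M × Bool) :=
  (PMF.uniformOfFintype (Fin M)).toMeasure.bind fun i =>
    (bernoulliMeasure true false (w i)).map fun b => (i, b)

/-- The importance-weighted error of a draw `d = (i, ξ)` at threshold `u`,
`Z(u) = ℓ(S i) (ξ / w i) 1{U i ≤ u}`. -/
def weightedError {M : ℕ} (S : Fin M → Bool) (U : Fin M → ℝ) (w : Fin M → unitInterval)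
    (u : ℝ) (d : Fin M × Bool) : ℝ :=
  loss (S d.1) * ((if d.2 then 1 else 0) / (w d.1 : ℝ)) * (if U d.1 ≤ u then 1 else 0)

/-- The empirical mean of the first `h` terms of a real sequence. -/
def empMean (z : ℕ → ℝ) (h : ℕ) : ℝ :=
  (1 / (h : ℝ)) * ∑ j ∈ Finset.range h, z j

/-- The empirical standard deviation (normalized by `h`) of the first `h` terms of a
real sequence. -/
def empStd (z : ℕ → ℝ) (h : ℕ) : ℝ :=
  Real.sqrt ((1 / (h : ℝ)) * ∑ j ∈ Finset.range h, (z j - empMean z h) ^ 2)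

/-- The `p`-quantile of the standard normal distribution. -/
def normalQuantile (p : ℝ) : ℝ :=
  sInf {x : ℝ | p ≤ cdf (gaussianReal 0 1) x}

/-- The upper bound `μ̂ + z_{1-γ} σ̂ / √h` computed from the first `h` terms of a
real sequence. -/
def upperBound (γ : ℝ) (z : ℕ → ℝ) (h : ℕ) : ℝ :=
  empMean z h + normalQuantile (1 - γ) * (empStd z h / Real.sqrt h)

end

end SelectiveExecution

open scoped Topology

namespace SelectiveExecution

/-! The weights cancel in expectation, so the draws `Z j` are i.i.d., bounded, with mean
`cumErrorLE`, which dominates `cumError`; covering the mean therefore proves both claims. If the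
variance `σ ^ 2` is positive, the CLT, consistency of `empStd` and Slutsky show that `√h *
(upperBound - mean)` converges in law to `σ * (q - Y)`, with `Y` standard normal and `q` the
quantile. Portmanteau on `(0, ∞)` bounds the liminf of the coverage below by the normal mass of `Y <
q`, which is at least `1 - γ`. If the variance vanishes, the bound almost surely equals the mean. -/

/-- The `p`-quantile of the standard normal law attains at least the level `p`. -/
lemma le_cdf_normalQuantile {p : ℝ} (hp0 : 0 < p) (hp1 : p < 1) :
    p ≤ cdf (gaussianReal 0 1) (normalQuantile p) := by
  set F := cdf (gaussianReal 0 1)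
  obtain ⟨b, hb⟩ : ∃ b, p ≤ F b :=
    ((tendsto_cdf_atTop (gaussianReal 0 1)).eventually (eventually_ge_nhds hp1)).exists
  obtain ⟨a, ha⟩ : ∃ a, F a < p :=
    ((tendsto_cdf_atBot (gaussianReal 0 1)).eventually (eventually_lt_nhds hp0)).exists
  have hbdd : BddBelow {x | p ≤ F x} :=
    ⟨a, fun x hx => le_of_lt (F.mono.reflect_lt (ha.trans_le hx))⟩
  -- Every point to the right of the infimum lies in the upper set `p ≤ F x`; right continuity
  -- carries the inequality to the infimum itself.
  have hright : Tendsto F (𝓝[>] normalQuantile p) (𝓝 (F (normalQuantile p))) :=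
    ((F.right_continuous _).mono Set.Ioi_subset_Ici_self).tendsto
  refine ge_of_tendsto hright ?_
  filter_upwards [self_mem_nhdsWithin] with x hx
  obtain ⟨y, hy, hyx⟩ := (csInf_lt_iff hbdd ⟨b, hb⟩).1 (Set.mem_Ioi.1 hx)
  exact le_trans hy (F.mono hyx.le)

/-- The empirical variance is the empirical second moment minus the squared empirical mean. -/
lemma empStd_eq (z : ℕ → ℝ) {h : ℕ} (hh : h ≠ 0) :
    empStd z h = √((∑ j ∈ Finset.range h, z j ^ 2) / h - ((∑ j ∈ Finset.range h, z j) / h) ^ 2) := by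
  have hh' : (h : ℝ) ≠ 0 := by exact_mod_cast hh
  rw [empStd]
  congr 1
  simp only [sub_sq, Finset.sum_add_distrib, Finset.sum_sub_distrib, ← Finset.sum_mul,
    ← Finset.mul_sum, Finset.sum_const, Finset.card_range, nsmul_eq_mul, empMean]
  field_simp
  ring

/-- Serves the zero-variance case. At `h = 0` it can fail, since division by zero makes the bound
`0`. -/
lemma upperBound_of_const {γ m : ℝ} {z : ℕ → ℝ} (hz : ∀ j, z j = m) {h : ℕ} (hh : h ≠ 0) :
    upperBound γ z h = m := by
  have hh' : (h : ℝ) ≠ 0 := by exact_mod_cast hh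
  have hmean : empMean z h = m := by simp [empMean, hz, hh']
  simp [upperBound, empStd, hmean, hz]

section Coverage

variable {Ω : Type*} [MeasurableSpace Ω] {P : Measure Ω} [IsProbabilityMeasure P] {Z : ℕ → Ω → ℝ}

/-- The empirical standard deviation is strongly consistent. -/
lemma tendsto_empStd_ae (hZ : MemLp (Z 0) 2 P) (hindep : iIndepFun Z P)
    (hident : ∀ j, IdentDistrib (Z j) (Z 0) P P) :
    ∀ᵐ x ∂P, Tendsto (fun h => empStd (fun j => Z j x) h) atTop (𝓝 √Var[Z 0; P]) := by
  have h1 := strong_law_ae_real Z (hZ.integrable (by norm_num))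
    (fun i j hij => hindep.indepFun hij) hident
  have h2 := strong_law_ae_real (fun j x => Z j x ^ 2) hZ.integrable_sq
    (fun i j hij => (hindep.indepFun hij).comp (measurable_id.pow_const 2)
      (measurable_id.pow_const 2))
    (fun j => (hident j).comp (measurable_id.pow_const 2))
  filter_upwards [h1, h2] with x hx1 hx2
  rw [variance_eq_sub hZ]
  refine ((hx2.sub (hx1.pow 2)).sqrt).congr' ?_
  filter_upwards [eventually_ne_atTop 0] with h hh
  exact (empStd_eq _ hh).symm

/-- If the law has positive variance, the studentized upper bound exceeds the mean with asymptotic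
probability at least the standard normal mass below the quantile. -/
lemma gaussianReal_Iio_le_liminf_measure_upperBound (hZ : MemLp (Z 0) 2 P) (hindep : iIndepFun Z P)
    (hident : ∀ j, IdentDistrib (Z j) (Z 0) P P) (hvar : Var[Z 0; P] ≠ 0) (γ : ℝ) :
    gaussianReal 0 1 (Set.Iio (normalQuantile (1 - γ))) ≤
      liminf (fun h : ℕ => P {x | P[Z 0] ≤ upperBound γ (fun j => Z j x) h}) atTop := by
  set q := normalQuantile (1 - γ)
  set σ := √Var[Z 0; P]
  have hσ : 0 < σ := Real.sqrt_pos.2 (lt_of_le_of_ne (variance_nonneg _ _) hvar.symm)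
  have hmeas : ∀ j, AEMeasurable (Z j) P := fun j => (hident j).aemeasurable_fst
  -- The Gaussian limit is represented with the sign `-σ`, so that positivity of the limit reads `y
  -- < q`, a lower tail.
  have hY : HasLaw (fun y : ℝ => -σ * y) (gaussianReal 0 Var[Z 0; P].toNNReal)
      (gaussianReal 0 1) := by
    convert! gaussianReal_const_mul (HasLaw.id (μ := gaussianReal 0 1)) (-σ) using 1
    congr 1
    · simp
    · ext
      simp [σ, Real.sq_sqrt (variance_nonneg _ _), variance_nonneg]
  have hclt := tendstoInDistribution_inv_sqrt_mul_sum_sub hY hZ hindep hident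
  have hstdm : ∀ h : ℕ, AEMeasurable (fun x => empStd (fun j => Z j x) h) P := by
    intro h
    unfold empStd empMean
    fun_prop
  have hstd : TendstoInMeasure P (fun (h : ℕ) x => empStd (fun j => Z j x) h) atTop
      (fun _ => σ) :=
    tendstoInMeasure_of_tendsto_ae (fun h => (hstdm h).aestronglyMeasurable)
      (tendsto_empStd_ae hZ hindep hident)
  -- Slutsky without dividing by `empStd`, which may vanish at finite `h`.
  have hT := hclt.continuous_comp_prodMk_of_tendstoInMeasure_const
    (g := fun p : ℝ × ℝ => p.1 + q * p.2) (by fun_prop) hstd hstdm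
  have hopen := ProbabilityMeasure.le_liminf_measure_open_of_tendsto hT.tendsto
    (isOpen_Ioi (a := (0 : ℝ)))
  simp only [ProbabilityMeasure.coe_mk] at hopen
  rw [Measure.map_apply (by fun_prop) measurableSet_Ioi] at hopen
  have hset : (fun y : ℝ => -σ * y + q * σ) ⁻¹' Set.Ioi 0 = Set.Iio q := by
    ext y
    simp only [Set.mem_preimage, Set.mem_Ioi, Set.mem_Iio]
    rw [show -σ * y + q * σ = σ * (q - y) by ring, mul_pos_iff_of_pos_left hσ, sub_pos]
  rw [hset] at hopen
  refine hopen.trans (liminf_le_liminf ?_)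
  filter_upwards [eventually_ne_atTop 0] with h hh
  rw [Measure.map_apply_of_aemeasurable (hT.forall_aemeasurable h) measurableSet_Ioi]
  refine measure_mono fun x hx => ?_
  have hh' : 0 < (h : ℝ) := by exact_mod_cast Nat.pos_of_ne_zero hh
  have hs : 0 < √(h : ℝ) := Real.sqrt_pos.2 hh'
  have key : (√(h : ℝ))⁻¹ * (∑ k ∈ Finset.range h, Z k x - h * P[Z 0]) +
      q * empStd (fun j => Z j x) h = √h * (upperBound γ (fun j => Z j x) h - P[Z 0]) := by
    have hsq : √(h : ℝ) ^ 2 = h := Real.sq_sqrt hh'.le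
    simp only [upperBound, empMean, q]
    generalize √(h : ℝ) = s at hs hsq ⊢
    rw [← hsq]
    field_simp
    ring
  have hx' : 0 < √(h : ℝ) * (upperBound γ (fun j => Z j x) h - P[Z 0]) := key ▸ hx
  exact sub_nonneg.1 (le_of_lt ((mul_pos_iff_of_pos_left hs).1 hx'))

/-- Asymptotic coverage of the studentized upper bound for any number below the mean. -/
theorem one_sub_le_liminf_measureReal_upperBound (hZ : MemLp (Z 0) 2 P) (hindep : iIndepFun Z P)
    (hident : ∀ j, IdentDistrib (Z j) (Z 0) P P) {γ : ℝ} (hγ0 : 0 < γ) (hγ1 : γ < 1) {a : ℝ}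
    (ha : a ≤ P[Z 0]) :
    1 - γ ≤ liminf (fun h : ℕ => P.real {x | a ≤ upperBound γ (fun j => Z j x) h}) atTop := by
  have hcobdd : IsCoboundedUnder (· ≥ ·) atTop
      (fun h : ℕ => P.real {x | a ≤ upperBound γ (fun j => Z j x) h}) :=
    isCoboundedUnder_ge_of_le atTop (fun _ => measureReal_le_one)
  by_cases hvar : Var[Z 0; P] = 0
  · have hconst : ∀ᵐ x ∂P, ∀ j, Z j x = P[Z 0] := by
      refine ae_all_iff.2 fun j => ?_
      have := ae_eq_integral_of_variance_eq_zero ((hident j).memLp_iff.2 hZ)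
        ((hident j).variance_eq.trans hvar)
      rwa [(hident j).integral_eq] at this
    refine le_liminf_of_le hcobdd ?_
    filter_upwards [eventually_ne_atTop 0] with h hh
    have hone : P {x | a ≤ upperBound γ (fun j => Z j x) h} = 1 := by
      rw [measure_congr (eventuallyEq_univ.2 ?_), measure_univ]
      filter_upwards [hconst] with x hx
      exact ha.trans (upperBound_of_const hx hh).ge
    simp [measureReal_def, hone, hγ0.le]
  -- The slack `c < c' < 1 - γ` turns the `ENNReal` liminf bound into an eventual inequality, which
  -- passes to real-valued probabilities.
  · refine le_of_forall_lt fun c hc => ?_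
    obtain ⟨c', hcc', hc'⟩ := exists_between hc
    refine hcc'.trans_le (le_liminf_of_le hcobdd ?_)
    have hlt : ENNReal.ofReal c' <
        liminf (fun h : ℕ => P {x | P[Z 0] ≤ upperBound γ (fun j => Z j x) h}) atTop := by
      refine lt_of_lt_of_le ?_ (gaussianReal_Iio_le_liminf_measure_upperBound hZ hindep hident hvar γ)
      -- No atoms: the open ray from portmanteau has the mass of the closed one, which is the cdf.
      have := nullSingletonClass_gaussianReal (μ := 0) (v := 1) one_ne_zero
      rw [measure_congr Iio_ae_eq_Iic, ← ofReal_cdf]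
      have hq := le_cdf_normalQuantile (p := 1 - γ) (by linarith) (by linarith)
      exact (ENNReal.ofReal_lt_ofReal_iff (by linarith)).2 (hc'.trans_le hq)
    filter_upwards [eventually_lt_of_lt_liminf hlt] with h hh
    refine (ENNReal.ofReal_le_iff_le_toReal (measure_ne_top _ _)).1 (hh.le.trans ?_)
    exact measure_mono fun x hx => ha.trans hx

end Coverage

section Sampling

variable {M : ℕ}

lemma cumError_le_cumErrorLE (S : Fin M → Bool) (U : Fin M → ℝ) (u : ℝ) :
    cumError S U u ≤ cumErrorLE S U u := by
  unfold cumError cumErrorLE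
  gcongr with i
  · unfold loss; split_ifs <;> norm_num
  · split_ifs with h1 h2 <;> first | exact absurd h1.le h2 | norm_num

variable [NeZero M]

/-- Integration against the law of one draw. -/
lemma integral_drawLaw (w : Fin M → unitInterval) (f : Fin M × Bool → ℝ) :
    ∫ d, f d ∂drawLaw w =
      (1 / (M : ℝ)) * ∑ i, ((w i : ℝ) * f (i, true) + (1 - (w i : ℝ)) * f (i, false)) := by
  -- The law of a draw is a uniform mixture of `M` two-point laws.
  have hlaw : drawLaw w = ∑ i, (M : ENNReal)⁻¹ • bernoulliMeasure (i, true) (i, false) (w i) := by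
    ext s hs
    rw [drawLaw, Measure.bind_apply hs (measurable_of_countable _).aemeasurable, lintegral_fintype,
      Measure.finsetSum_apply]
    refine Finset.sum_congr rfl fun i _ => ?_
    rw [PMF.toMeasure_apply_singleton _ _ (measurableSet_singleton i), map_bernoulliMeasure]
    simp [mul_comm]
  rw [hlaw, integral_finsetSum_measure, Finset.mul_sum]
  · refine Finset.sum_congr rfl fun i _ => ?_
    rw [integral_smul_measure, integral_bernoulliMeasure]
    simp
  · intro i _
    exact (integrable_bernoulliMeasure _ _ _ f).smul_measure
      (ENNReal.inv_ne_top.2 (by exact_mod_cast NeZero.ne M))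

/-- Unbiasedness of inverse-probability weighting: `w i * (1 / w i) = 1`, which needs `w i` nonzero.
-/
lemma integral_weightedError (S : Fin M → Bool) (U : Fin M → ℝ) {w : Fin M → unitInterval}
    (hw : ∀ i, 0 < (w i : ℝ)) (u : ℝ) :
    ∫ d, weightedError S U w u d ∂drawLaw w = cumErrorLE S U u := by
  rw [integral_drawLaw, cumErrorLE]
  congr 1
  refine Finset.sum_congr rfl fun i _ => ?_
  have := (hw i).ne'
  simp [weightedError]
  field_simp

end Sampling

end SelectiveExecution

theorem proposition2 {M : ℕ} [NeZero M]
    (S : Fin M → Bool) (U : Fin M → ℝ)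
    (w : Fin M → unitInterval) (hw : ∀ i, 0 < (w i : ℝ))
    (γ : ℝ) (hγ0 : 0 < γ) (hγ1 : γ < 1) (u : ℝ)
    {Ω : Type*} [MeasurableSpace Ω] (P : Measure Ω) [IsProbabilityMeasure P]
    (D : ℕ → Ω → Fin M × Bool)
    (hindep : iIndepFun D P)
    (hlaw : ∀ j, HasLaw (D j) (SelectiveExecution.drawLaw w) P) :
    1 - γ ≤ liminf (fun h : ℕ => P.real {x | SelectiveExecution.cumError S U u ≤
        SelectiveExecution.upperBound γ
          (fun j => SelectiveExecution.weightedError S U w u (D j x)) h}) atTop ∧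
    1 - γ ≤ liminf (fun h : ℕ => P.real {x | SelectiveExecution.cumErrorLE S U u ≤
        SelectiveExecution.upperBound γ
          (fun j => SelectiveExecution.weightedError S U w u (D j x)) h}) atTop := by
  have hmZ : Measurable (SelectiveExecution.weightedError S U w u) := measurable_of_countable _
  have hident : ∀ j, IdentDistrib (fun x => SelectiveExecution.weightedError S U w u (D j x))
      (fun x => SelectiveExecution.weightedError S U w u (D 0 x)) P P := fun j =>
    IdentDistrib.comp ⟨(hlaw j).aemeasurable, (hlaw 0).aemeasurable,
      (hlaw j).map_eq.trans (hlaw 0).map_eq.symm⟩ hmZ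
  have hindepZ : iIndepFun (fun j x => SelectiveExecution.weightedError S U w u (D j x)) P :=
    hindep.comp (fun _ => SelectiveExecution.weightedError S U w u) (fun _ => hmZ)
  -- A draw takes finitely many values, so the weighted error is bounded.
  have hLp : MemLp (fun x => SelectiveExecution.weightedError S U w u (D 0 x)) 2 P := by
    obtain ⟨C, hC⟩ := (Set.finite_range
      fun d => ‖SelectiveExecution.weightedError S U w u d‖).bddAbove
    exact MemLp.of_bound
      (hmZ.comp_aemeasurable (hlaw 0).aemeasurable).aestronglyMeasurable C
      (ae_of_all _ fun x => hC ⟨D 0 x, rfl⟩)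
  have hmean : P[fun x => SelectiveExecution.weightedError S U w u (D 0 x)] =
      SelectiveExecution.cumErrorLE S U u :=
    ((hlaw 0).integral_comp hmZ.aestronglyMeasurable).trans
      (SelectiveExecution.integral_weightedError S U hw u)
  exact ⟨SelectiveExecution.one_sub_le_liminf_measureReal_upperBound hLp hindepZ hident hγ0 hγ1
      ((SelectiveExecution.cumError_le_cumErrorLE S U u).trans hmean.ge),
    SelectiveExecution.one_sub_le_liminf_measureReal_upperBound hLp hindepZ hident hγ0 hγ1
      hmean.ge⟩
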